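/- Let $\mathcal H$ be a separable complex Hilbert space, and let $\{s_k\}_{k\in\mathbb N}$ and $\{w_k\}_{k\in\mathbb N}$ (with $\mathbb N=\{1,2,\dots\}$) be frames for their respective closed linear spans $\mathcal S$ and $\mathcal W$, with synthesis operators $S,W\colon\ell^2\to\mathcal H$, $Sx=\sum_k x_ks_k$ and $Wx=\sum_k x_kw_k$. Put $U:=S^*W$. Let $f\in\mathcal H$ and $n,m\in\mathbb N$, and let $\iota_n\colon\mathbb C^n\to\ell^2$, $\iota_n(x_1,\dots,x_n)=(x_1,\dots,x_n,0,0,\dots)$. Let $\mathcal W_n:=\operatorname{span}\{w_1,\dots,w_n\}$ and let $P_{\mathcal W_n^\perp}$ be the orthogonal projection onto $\mathcal W_n^\perp$. Let $(e_j)_{j\in\mathbb N}$ be the canonical basis of $\ell^2$ and let $$\Sigma:=\iota_n^*U^*U\iota_n,\qquad v_j:=\iota_n^*U^*e_j\in\mathbb C^n,\qquad u_j:=P_{\mathcal W_n^\perp}s_j .$$ Let $p=(p_j)_{j\in\mathbb N}$ be a probability distribution on $\mathbb N$, with $\operatorname{supp}(p)=\{j:p_j>0\}$. Assume that 1. $\mathcal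 W\cap\mathcal S^\perp=\{0\}$; 2. $R:=\sup_{j\in\operatorname{supp}(p)}\|v_j\|^2/p_j<\infty$ and $R':=\sup_{j\in\operatorname{supp}(p)}\|u_j\|^2/p_j<\infty$; 3. $p_j>0$ whenever $v_j\ne0$. Let $i_1,\dots,i_m$ be independent random indices with distribution $p$, write $\Omega=\{i_1,\dots,i_m\}$, and define $$Q_\Omega:=\frac1m\sum_{t=1}^m\frac{e_{i_t}\otimes e_{i_t}}{p_{i_t}},\qquad \widehat\Sigma_\Omega:=\iota_n^*U^*Q_\Omega U\iota_n,\qquad \widehat C_\Omega:=\iota_n^*U^*Q_\Omega S^*P_{\mathcal W_n^\perp}.$$ Here $(a\otimes b)x=\langle x,b\rangle a$, $\|\cdot\|$ denotes the Hilbert space norm or the operator norm, and $A^\dagger$ is the Moore–Penrose pseudo-inverse of $A$. Let $\delta\in(0,1)$. If $$m\ge\tfrac83\,R\,\|\Sigma\|\,\|\Sigma^\dagger\|^2\log(2n/\delta),$$ then, with probability at least $1-\delta$, the following holds: the weighted least-squares problem $$\underset{x\in\mathbb C^n}{\operatorname{argmin}}\ \sum_{t=1}^m\frac1{p_{i_t}}\bigl|\langle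 W\iota_nx,s_{i_t}\rangle-\langle f,s_{i_t}\rangle\bigr|^2$$ has a unique solution $\tilde x$ of minimal Euclidean norm, and the reconstruction $\tilde f:=W\iota_n\tilde x$ satisfies $$\|f-\tilde f\|\le\|P_{\mathcal W_n^\perp}f\|\,\bigl(1+K_{n,\Omega}^2\bigr)^{1/2},\qquad K_{n,\Omega}:=\bigl\|W\iota_n\widehat\Sigma_\Omega^\dagger\widehat C_\Omega\bigr\| .$$ -/

import Mathlib

open MeasureTheory ProbabilityTheory

noncomputable section

namespace GenSampling

/-- The Hilbert space `ℓ²` of square summable complex sequences. Sequences are indexed from `0`,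
so the `k`-th term of a sequence `(x_k)_{k ≥ 1}` is the term with index `k - 1` here. -/
abbrev Ell2 : Type := lp (fun _ : ℕ => ℂ) 2

/-- `ℂⁿ` with the Euclidean inner product. -/
abbrev Cn (n : ℕ) : Type := EuclideanSpace ℂ (Fin n)

/-- The canonical basis vector `e_j` of `ℓ²`. -/
def stdBasis (j : ℕ) : Ell2 := lp.single 2 j (1 : ℂ)

section MoorePenrose

variable {E F : Type*} [NormedAddCommGroup E] [InnerProductSpace ℂ E] [FiniteDimensional ℂ E]
  [NormedAddCommGroup F] [InnerProductSpace ℂ F] [FiniteDimensional ℂ F]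

/-- The four Penrose equations: `B` is the Moore-Penrose pseudo-inverse of `A`. -/
structure IsPseudoInverse (A : E →L[ℂ] F) (B : F →L[ℂ] E) : Prop where
  mul_mul_left : A ∘L B ∘L A = A
  mul_mul_right : B ∘L A ∘L B = B
  selfAdjoint_left : IsSelfAdjoint (A ∘L B)
  selfAdjoint_right : IsSelfAdjoint (B ∘L A)

theorem exists_isPseudoInverse (A : E →L[ℂ] F) : ∃ B : F →L[ℂ] E, IsPseudoInverse A B := by
  set K := LinearMap.ker A.toLinearMap with hK
  set R := LinearMap.range A.toLinearMap with hR
  obtain ⟨g, hg⟩ := A.toLinearMap.rangeRestrict.exists_rightInverse_of_surjective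
    (LinearMap.range_rangeRestrict _)
  have hg' : ∀ y : R, A (g y) = y := fun y => by
    have := congrArg Subtype.val (LinearMap.congr_fun hg y)
    simpa using this
  have hP : ∀ x, A (Kᗮ.starProjection x) = A x := fun x => by
    have h : x - Kᗮ.starProjection x ∈ Kᗮᗮ := Submodule.sub_starProjection_mem_orthogonal x
    rw [Submodule.orthogonal_orthogonal] at h
    have h2 : A (x - Kᗮ.starProjection x) = 0 := h
    rw [map_sub, sub_eq_zero] at h2
    exact h2.symm
  let B : F →L[ℂ] E := Kᗮ.starProjection ∘L (LinearMap.toContinuousLinearMap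
    (g ∘ₗ (R.orthogonalProjectionOnto : F →L[ℂ] R).toLinearMap))
  have hAB : A ∘L B = R.starProjection := by
    ext y
    simp only [B, ContinuousLinearMap.comp_apply]
    rw [hP]
    exact hg' _
  have hBA : B ∘L A = Kᗮ.starProjection := by
    ext x
    have h1 : R.orthogonalProjectionOnto (A x) = ⟨A x, ⟨x, rfl⟩⟩ :=
      Submodule.orthogonalProjectionOnto_mem_subspace_eq_self (K := R) ⟨A x, ⟨x, rfl⟩⟩
    have h2 : g ⟨A x, ⟨x, rfl⟩⟩ - x ∈ K := by
      rw [hK, LinearMap.mem_ker]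
      simpa [sub_eq_zero] using hg' ⟨A x, ⟨x, rfl⟩⟩
    have h3 : Kᗮ.starProjection (g ⟨A x, ⟨x, rfl⟩⟩ - x) = 0 := by
      rw [Submodule.starProjection_apply_eq_zero_iff, Submodule.orthogonal_orthogonal]
      exact h2
    rw [map_sub, sub_eq_zero] at h3
    rw [← h3, ← h1]
    rfl
  refine ⟨B, ?_, ?_, ?_, ?_⟩
  · rw [hBA]
    ext x
    exact hP x
  · rw [hAB]
    ext y
    simp only [B, ContinuousLinearMap.comp_apply, LinearMap.coe_toContinuousLinearMap',
      LinearMap.comp_apply, ContinuousLinearMap.coe_coe]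
    congr 2
    exact Submodule.orthogonalProjectionOnto_mem_subspace_eq_self (K := R)
      (R.orthogonalProjectionOnto y)
  · rw [hAB]
    exact isSelfAdjoint_starProjection R
  · rw [hBA]
    exact isSelfAdjoint_starProjection Kᗮ

theorem IsPseudoInverse.unique {A : E →L[ℂ] F} {B B' : F →L[ℂ] E}
    (h : IsPseudoInverse A B) (h' : IsPseudoInverse A B') : B = B' := by
  have hAB : A ∘L B = A ∘L B' := by
    have e1 : (A ∘L B') * (A ∘L B) = A ∘L B := by
      conv_rhs => rw [← h'.mul_mul_left]
      rfl
    have e2 : (A ∘L B) * (A ∘L B') = A ∘L B' := by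
      conv_rhs => rw [← h.mul_mul_left]
      rfl
    have e3 := congrArg star e1
    rw [star_mul, h.selfAdjoint_left.star_eq, h'.selfAdjoint_left.star_eq, e2] at e3
    exact e3.symm
  have hBA : B ∘L A = B' ∘L A := by
    have e1 : (B ∘L A) * (B' ∘L A) = B ∘L A := by
      conv_rhs => rw [← h'.mul_mul_left]
      rfl
    have e2 : (B' ∘L A) * (B ∘L A) = B' ∘L A := by
      conv_rhs => rw [← h.mul_mul_left]
      rfl
    have e3 := congrArg star e1
    rw [star_mul, h.selfAdjoint_right.star_eq, h'.selfAdjoint_right.star_eq, e2] at e3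
    exact e3.symm
  calc B = B ∘L A ∘L B := h.mul_mul_right.symm
    _ = B ∘L A ∘L B' := by rw [hAB]
    _ = (B ∘L A) ∘L B' := rfl
    _ = (B' ∘L A) ∘L B' := by rw [hBA]
    _ = B' := h'.mul_mul_right

/-- The Moore-Penrose pseudo-inverse `A†`, the unique solution of the four Penrose equations. -/
def pinv (A : E →L[ℂ] F) : F →L[ℂ] E := (exists_isPseudoInverse A).choose

theorem pinv_spec (A : E →L[ℂ] F) : IsPseudoInverse A (pinv A) :=
  (exists_isPseudoInverse A).choose_spec

end MoorePenrose

variable {H : Type*} [NormedAddCommGroup H] [InnerProductSpace ℂ H]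

/-- The closed linear span of a sequence. -/
def closedSpan (v : ℕ → H) : Submodule ℂ H := (Submodule.span ℂ (Set.range v)).topologicalClosure

/-- `v` is a frame for its closed linear span. -/
def IsFrameForSpan (v : ℕ → H) : Prop :=
  ∃ α β : ℝ, 0 < α ∧ 0 < β ∧ ∀ h ∈ closedSpan v,
    Summable (fun k => ‖inner ℂ (v k) h‖ ^ 2) ∧
    α * ‖h‖ ^ 2 ≤ ∑' k, ‖inner ℂ (v k) h‖ ^ 2 ∧
    ∑' k, ‖inner ℂ (v k) h‖ ^ 2 ≤ β * ‖h‖ ^ 2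

variable [CompleteSpace H]

instance (v : ℕ → H) : (closedSpan v).HasOrthogonalProjection :=
  haveI : CompleteSpace (closedSpan v) :=
    (Submodule.isClosed_topologicalClosure _).completeSpace_coe
  inferInstance

theorem IsFrameForSpan.bessel {v : ℕ → H} (hv : IsFrameForSpan v) :
    ∃ β : ℝ, 0 < β ∧ ∀ h : H, Summable (fun k => ‖inner ℂ (v k) h‖ ^ 2) ∧
      ∑' k, ‖inner ℂ (v k) h‖ ^ 2 ≤ β * ‖h‖ ^ 2 := by
  obtain ⟨α, β, -, hβ, H1⟩ := hv
  refine ⟨β, hβ, fun h => ?_⟩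
  have hmem : ∀ k, v k ∈ closedSpan v := fun k =>
    Submodule.le_topologicalClosure _ (Submodule.subset_span ⟨k, rfl⟩)
  have hin : ∀ k, inner ℂ (v k) ((closedSpan v).starProjection h) = inner ℂ (v k) h := fun k => by
    have := Submodule.sub_starProjection_mem_orthogonal (K := closedSpan v) h _ (hmem k)
    rw [inner_sub_right, sub_eq_zero] at this
    exact this.symm
  obtain ⟨h1, -, h3⟩ := H1 ((closedSpan v).starProjection h) (Submodule.starProjection_apply_mem _ h)
  simp only [hin] at h1 h3
  refine ⟨h1, h3.trans ?_⟩
  gcongr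
  exact Submodule.norm_starProjection_apply_le _ h

theorem IsFrameForSpan.exists_synthesis {v : ℕ → H} (hv : IsFrameForSpan v) :
    ∃ T : Ell2 →L[ℂ] H, ∀ x : Ell2, HasSum (fun k => x k • v k) (T x) := by
  obtain ⟨β, hβ, hB⟩ := hv.bessel
  have hmem : ∀ h : H, Memℓp (fun k => (inner ℂ (v k) h : ℂ)) 2 := fun h => by
    apply memℓp_gen
    simpa using (hB h).1
  let A0 : H →ₗ[ℂ] Ell2 :=
    { toFun := fun h => ⟨fun k => inner ℂ (v k) h, hmem h⟩
      map_add' := fun a b => by ext k; exact inner_add_right _ _ _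
      map_smul' := fun c a => by ext k; exact inner_smul_right _ _ _ }
  let A : H →L[ℂ] Ell2 := A0.mkContinuous (Real.sqrt β) (fun h => by
    refine (sq_le_sq₀ (norm_nonneg _) (by positivity)).1 ?_
    have e := lp.norm_rpow_eq_tsum (p := 2) (by norm_num) (A0 h)
    simp only [ENNReal.toReal_ofNat, Real.rpow_ofNat] at e
    rw [mul_pow, Real.sq_sqrt hβ.le, e]
    exact (hB h).2)
  refine ⟨ContinuousLinearMap.adjoint A, fun x => ?_⟩
  have h1 := (lp.hasSum_single (p := 2) (by norm_num) x).mapL (ContinuousLinearMap.adjoint A)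
  convert h1 using 2 with k
  refine ext_inner_right ℂ fun h => ?_
  rw [ContinuousLinearMap.adjoint_inner_left, lp.inner_single_left, inner_smul_left]
  change _ = inner ℂ (x k) (inner ℂ (v k) h : ℂ)
  simp [mul_comm]

/-- The synthesis operator `x ↦ ∑ x_k v_k` of a frame `v` for its closed span. -/
def synthesis (v : ℕ → H) (hv : IsFrameForSpan v) : Ell2 →L[ℂ] H where
  toFun x := ∑' k, x k • v k
  map_add' x y := by
    obtain ⟨T, hT⟩ := hv.exists_synthesis
    rw [(hT _).tsum_eq, (hT _).tsum_eq, (hT _).tsum_eq, map_add]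
  map_smul' c x := by
    obtain ⟨T, hT⟩ := hv.exists_synthesis
    rw [(hT _).tsum_eq, (hT _).tsum_eq, map_smul]
    rfl
  cont := by
    obtain ⟨T, hT⟩ := hv.exists_synthesis
    simp only [(hT _).tsum_eq]
    exact T.continuous

theorem hasSum_synthesis (v : ℕ → H) (hv : IsFrameForSpan v) (x : Ell2) :
    HasSum (fun k => x k • v k) (synthesis v hv x) := by
  obtain ⟨T, hT⟩ := hv.exists_synthesis
  exact (hT x).summable.hasSum

/-- `ι_n : ℂⁿ → ℓ²`, `(x_1, …, x_n) ↦ (x_1, …, x_n, 0, 0, …)`. -/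
def embed (n : ℕ) : Cn n →L[ℂ] Ell2 :=
  LinearMap.toContinuousLinearMap
    { toFun := fun x => ∑ k : Fin n, x k • stdBasis k
      map_add' := fun x y => by simp [add_smul, Finset.sum_add_distrib]
      map_smul' := fun c x => by simp [mul_smul, Finset.smul_sum] }

/-- `Q_Ω = (1/m) ∑_t (e_{i_t} ⊗ e_{i_t}) / p_{i_t}`, where `(a ⊗ b) x = ⟨x, b⟩ a`. -/
def weightedProj (p : ℕ → ℝ) {m : ℕ} (i : Fin m → ℕ) : Ell2 →L[ℂ] Ell2 :=
  ((1 / m : ℝ) : ℂ) • ∑ t : Fin m, ((1 / p (i t) : ℝ) : ℂ) •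
    InnerProductSpace.rankOne ℂ (stdBasis (i t)) (stdBasis (i t))

/-- `U = S* W`. -/
def crossOp (S W : Ell2 →L[ℂ] H) : Ell2 →L[ℂ] Ell2 := ContinuousLinearMap.adjoint S ∘L W

/-- `ι_n* U*`. -/
def crossAdj (S W : Ell2 →L[ℂ] H) (n : ℕ) : Ell2 →L[ℂ] Cn n :=
  ContinuousLinearMap.adjoint (embed n) ∘L ContinuousLinearMap.adjoint (crossOp S W)

/-- The Gram matrix `Σ = ι_n* U* U ι_n`. -/
def gram (S W : Ell2 →L[ℂ] H) (n : ℕ) : Cn n →L[ℂ] Cn n :=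
  crossAdj S W n ∘L crossOp S W ∘L embed n

/-- The empirical Gram matrix `Σ̂_Ω = ι_n* U* Q_Ω U ι_n`. -/
def empGram (S W : Ell2 →L[ℂ] H) (n : ℕ) (p : ℕ → ℝ) {m : ℕ} (i : Fin m → ℕ) :
    Cn n →L[ℂ] Cn n :=
  crossAdj S W n ∘L weightedProj p i ∘L crossOp S W ∘L embed n

/-- `W_n = span {w_1, …, w_n}`. -/
def reconSpace (w : ℕ → H) (n : ℕ) : Submodule ℂ H :=
  Submodule.span ℂ (Set.range fun k : Fin n => w k)

/-- The orthogonal projection of `H` onto the orthogonal complement of `W_n`. -/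
def tailProj (w : ℕ → H) (n : ℕ) : H →L[ℂ] H := (reconSpace w n)ᗮ.starProjection

/-- The empirical cross-term `Ĉ_Ω = ι_n* U* Q_Ω S* P_{W_n^⊥}`. -/
def empCross (S W : Ell2 →L[ℂ] H) (w : ℕ → H) (n : ℕ) (p : ℕ → ℝ) {m : ℕ} (i : Fin m → ℕ) :
    H →L[ℂ] Cn n :=
  crossAdj S W n ∘L weightedProj p i ∘L ContinuousLinearMap.adjoint S ∘L tailProj w n

/-- `K_{n,Ω} = ‖W ι_n Σ̂_Ω† Ĉ_Ω‖`. -/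
def aliasConst (S W : Ell2 →L[ℂ] H) (w : ℕ → H) (n : ℕ) (p : ℕ → ℝ) {m : ℕ} (i : Fin m → ℕ) : ℝ :=
  ‖W ∘L embed n ∘L pinv (empGram S W n p i) ∘L empCross S W w n p i‖

/-- `v_j = ι_n* U* e_j`. -/
def interVec (S W : Ell2 →L[ℂ] H) (n : ℕ) (j : ℕ) : Cn n := crossAdj S W n (stdBasis j)

/-- The values `‖v_j‖² / p_j`, for `j` in the support of `p`; here `v` is a sequence of vectors. -/
def coherenceSet {E : Type*} [NormedAddCommGroup E] (p : ℕ → ℝ) (v : ℕ → E) : Set ℝ :=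
  {r | ∃ j, 0 < p j ∧ r = ‖v j‖ ^ 2 / p j}

/-- `sup_{j ∈ supp p} ‖v_j‖² / p_j`, to be used where this supremum is finite. -/
def coherence {E : Type*} [NormedAddCommGroup E] (p : ℕ → ℝ) (v : ℕ → E) : ℝ :=
  sSup (coherenceSet p v)

/-- The weighted least-squares objective
`∑_t |⟨W ι_n x, s_{i_t}⟩ - ⟨f, s_{i_t}⟩|² / p_{i_t}`. (Mathlib's inner product is linear in its
second argument.) -/
def lsObjective (W : Ell2 →L[ℂ] H) (s : ℕ → H) (f : H) (n : ℕ) (p : ℕ → ℝ) {m : ℕ}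
    (i : Fin m → ℕ) (x : Cn n) : ℝ :=
  ∑ t : Fin m, 1 / p (i t) * ‖inner ℂ (s (i t)) (W (embed n x)) - inner ℂ (s (i t)) f‖ ^ 2

/-- The set of minimizers of a real function. -/
def argmin {X : Type*} (g : X → ℝ) : Set X := {x | ∀ y, g x ≤ g y}

/-- `x` is a minimizer of `g` of minimal norm among all minimizers of `g`. -/
def IsMinNormMinimizer {X : Type*} [Norm X] (g : X → ℝ) (x : X) : Prop :=
  x ∈ argmin g ∧ ∀ y ∈ argmin g, ‖x‖ ≤ ‖y‖

end GenSampling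

end

open GenSampling

/-!
The event on which the reconstruction works is that the sampled vectors `v_{i_t}` separate the
points of `V = (ker U ι_n)^⊥`. All `v_j` lie in `V`, and `Σ̂_Ω` is the average of the rank-one
operators `v_{i_t} ⊗ v_{i_t} / p_{i_t}`, so on this event `Σ̂_Ω` has the kernel of `U ι_n`, which is
the kernel of `W ι_n` because `W ∩ S^⊥ = 0` (`synthesis_embed_eq_zero_of_crossOp`).

*Probability of the event.* No matrix concentration inequality is needed, since only the kernel of
`Σ̂_Ω` matters and not its distance to `Σ`. Let `K` be the subspace of `V` orthogonal to the vectors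
sampled so far. With `B = ‖Σ‖ ‖Σ†‖²` there is a lower bound `‖x‖² ≤ B ∑_j |⟨v_j, x⟩|²` on `V`
(`norm_sq_le_of_mem_orthogonal_ker`). Summed over an orthonormal basis of `K`, and combined with
Bessel's inequality and `‖v_j‖² ≤ R p_j`, it gives
`dim K ≤ B R · ℙ(the next sample is not orthogonal to K)` (`finrank_le_tsum_not_orthogonal`). A
sample that is not orthogonal to `K` lowers the dimension by one, so the expected dimension shrinks
by the factor `1 - 1 / (B R) ≤ exp (-1 / (B R))` with every sample. After `m` independent samples it
is at most `n exp (-m / (B R)) ≤ δ`, and Markov's inequality bounds the probability that `K ≠ 0`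
(`measure_unseenPart_eq_bot_ge`).

*Error bound on the event.* For every choice of samples, the least-squares solution of minimal norm
is `x̃ = Σ̂_Ω† ι_n* U* Q_Ω S* f` (`isMinNormMinimizer_lsObjective_iff`). Write
`f = W ι_n z + P_{W_n^⊥} f`. The first summand is reproduced exactly, because `Σ̂_Ω† Σ̂_Ω z - z` lies
in the kernel of `Σ̂_Ω`, hence in that of `W ι_n`; the second contributes
`W ι_n Σ̂_Ω† Ĉ_Ω P_{W_n^⊥} f ∈ W_n`. The bound is then Pythagoras
(`norm_sub_reconstruction_le`).
-/

/-! ### Random sections of a subspace by hyperplanes -/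

section RandomSections

variable {E : Type*} [NormedAddCommGroup E] [InnerProductSpace ℂ E] [FiniteDimensional ℂ E]

/-- The vectors of `V` that are orthogonal to each of the vectors `v (i 0), …, v (i (k - 1))`. -/
noncomputable def unseenPart (V : Submodule ℂ E) (v : ℕ → E) {k : ℕ} (i : Fin k → ℕ) :
    Submodule ℂ E :=
  V ⊓ ⨅ t, (ℂ ∙ v (i t))ᗮ

omit [FiniteDimensional ℂ E] in
theorem mem_unseenPart {V : Submodule ℂ E} {v : ℕ → E} {k : ℕ} {i : Fin k → ℕ} {x : E} :
    x ∈ unseenPart V v i ↔ x ∈ V ∧ ∀ t, inner ℂ (v (i t)) x = 0 := by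
  simp [unseenPart, Submodule.mem_iInf, Submodule.mem_orthogonal_singleton_iff_inner_right]

omit [FiniteDimensional ℂ E] in
theorem unseenPart_cons (V : Submodule ℂ E) (v : ℕ → E) {k : ℕ} (j : ℕ) (i : Fin k → ℕ) :
    unseenPart V v (Fin.cons j i : Fin (k + 1) → ℕ) = unseenPart V v i ⊓ (ℂ ∙ v j)ᗮ := by
  ext x
  simp only [Submodule.mem_inf, mem_unseenPart, Fin.forall_fin_succ, Fin.cons_zero, Fin.cons_succ,
    Submodule.mem_orthogonal_singleton_iff_inner_right]
  tauto

open Classical in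
/-- Summing the lower frame bound over an orthonormal basis of `K` bounds `dim K` by the
probability of drawing a vector that is not orthogonal to `K`. -/
theorem finrank_le_tsum_not_orthogonal {v : ℕ → E} {p : ℕ → ℝ} {B R : ℝ} (hB : 0 ≤ B)
    (hp : ∀ j, 0 ≤ p j) (hps : Summable p) (hR : ∀ j, ‖v j‖ ^ 2 ≤ R * p j) {K : Submodule ℂ E}
    (hlow : ∀ x ∈ K, Summable (fun j => ‖inner ℂ (v j) x‖ ^ 2) ∧
      ‖x‖ ^ 2 ≤ B * ∑' j, ‖inner ℂ (v j) x‖ ^ 2) :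
    (Module.finrank ℂ K : ℝ) ≤ B * R * ∑' j, if K ≤ (ℂ ∙ v j)ᗮ then 0 else p j := by
  set b := stdOrthonormalBasis ℂ K
  have hb : Orthonormal ℂ (fun l => (b l : E)) := b.orthonormal.comp_linearIsometry K.subtypeₗᵢ
  have hind : Summable fun j => if K ≤ (ℂ ∙ v j)ᗮ then 0 else p j := by
    refine Summable.of_nonneg_of_le (fun j => ?_) (fun j => ?_) hps
    · split_ifs <;> simp [hp]
    · split_ifs <;> simp [hp]
  have hsum : ∀ j, ∑ l, ‖inner ℂ (v j) (b l : E)‖ ^ 2 ≤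
      R * if K ≤ (ℂ ∙ v j)ᗮ then 0 else p j := by
    intro j
    split_ifs with h
    · have : ∀ l, inner ℂ (v j) (b l : E) = 0 := fun l =>
        Submodule.mem_orthogonal_singleton_iff_inner_right.1 (h (b l).2)
      simp [this]
    · refine le_trans ?_ (hR j)
      simp_rw [norm_inner_symm (v j)]
      exact hb.sum_inner_products_le (v j) (s := Finset.univ)
  calc (Module.finrank ℂ K : ℝ) = ∑ l, ‖(b l : E)‖ ^ 2 := by simp [hb.norm_eq_one]
    _ ≤ ∑ l, B * ∑' j, ‖inner ℂ (v j) (b l : E)‖ ^ 2 :=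
      Finset.sum_le_sum fun l _ => (hlow _ (b l).2).2
    _ = B * ∑' j, ∑ l, ‖inner ℂ (v j) (b l : E)‖ ^ 2 := by
      rw [← Finset.mul_sum, Summable.tsum_finsetSum fun l _ => (hlow _ (b l).2).1]
    _ ≤ B * ∑' j, R * (if K ≤ (ℂ ∙ v j)ᗮ then 0 else p j) := by
      gcongr
      · exact summable_sum fun l _ => (hlow _ (b l).2).1
      · exact hind.mul_left R
      · exact hsum _
    _ = _ := by rw [tsum_mul_left, mul_assoc]

/-- Intersecting `K` with the hyperplane orthogonal to a random `v j` lowers the dimension by one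
unless `v j` is orthogonal to `K`, so the dimension contracts by a fixed factor on average. -/
theorem tsum_finrank_inf_orthogonal_le {v : ℕ → E} {p : ℕ → ℝ} {B R : ℝ} (hB : 0 ≤ B) (hR0 : 0 ≤ R)
    (hp : ∀ j, 0 ≤ p j) (hps : HasSum p 1) (hR : ∀ j, ‖v j‖ ^ 2 ≤ R * p j) {K : Submodule ℂ E}
    (hlow : ∀ x ∈ K, Summable (fun j => ‖inner ℂ (v j) x‖ ^ 2) ∧
      ‖x‖ ^ 2 ≤ B * ∑' j, ‖inner ℂ (v j) x‖ ^ 2) :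
    Summable (fun j => p j * Module.finrank ℂ ↥(K ⊓ (ℂ ∙ v j)ᗮ)) ∧
    ∑' j, p j * Module.finrank ℂ ↥(K ⊓ (ℂ ∙ v j)ᗮ) ≤
      Real.exp (-(1 / (B * R))) * Module.finrank ℂ K := by
  classical
  have hle := finrank_le_tsum_not_orthogonal hB hp hps.summable hR hlow
  set c : ℝ := (Module.finrank ℂ K : ℝ)
  set q : ℕ → ℝ := fun j => if K ≤ (ℂ ∙ v j)ᗮ then 0 else p j with hq
  have hqs : Summable q := by
    refine Summable.of_nonneg_of_le (fun j => ?_) (fun j => ?_) hps.summable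
    · simp only [hq]; split_ifs <;> simp [hp]
    · simp only [hq]; split_ifs <;> simp [hp]
  have hdom : ∀ j, p j * Module.finrank ℂ ↥(K ⊓ (ℂ ∙ v j)ᗮ) ≤ p j * c - q j := by
    intro j
    simp only [hq]
    split_ifs with h
    · rw [inf_eq_left.2 h, sub_zero]
    · have hlt : Module.finrank ℂ ↥(K ⊓ (ℂ ∙ v j)ᗮ) < Module.finrank ℂ K :=
        Submodule.finrank_lt_finrank_of_lt (inf_le_left.lt_of_ne fun he => h (inf_eq_left.1 he))
      have : (Module.finrank ℂ ↥(K ⊓ (ℂ ∙ v j)ᗮ) : ℝ) + 1 ≤ c := by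
        simp only [c]
        exact_mod_cast hlt
      nlinarith [hp j]
  have hs2 : Summable fun j => p j * c - q j := (hps.summable.mul_right c).sub hqs
  have hs1 : Summable (fun j => p j * (Module.finrank ℂ ↥(K ⊓ (ℂ ∙ v j)ᗮ) : ℝ)) :=
    Summable.of_nonneg_of_le (fun j => mul_nonneg (hp j) (Nat.cast_nonneg _)) hdom hs2
  refine ⟨hs1, ?_⟩
  have h1 : ∑' j, p j * (Module.finrank ℂ ↥(K ⊓ (ℂ ∙ v j)ᗮ) : ℝ) ≤ c - ∑' j, q j := by
    refine (hs1.tsum_le_tsum hdom hs2).trans_eq ?_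
    rw [(hps.summable.mul_right c).tsum_sub hqs, tsum_mul_right, hps.tsum_eq, one_mul]
  have hc : 0 ≤ c := Nat.cast_nonneg _
  have hq0 : 0 ≤ ∑' j, q j := tsum_nonneg fun j => by simp only [hq]; split_ifs <;> simp [hp]
  rcases (mul_nonneg hB hR0).eq_or_lt with h0 | h0
  · -- here `1 / (B * R)` is the junk value `0`
    rw [← h0]
    simpa using h1.trans (by linarith)
  · have h2 : c * (1 / (B * R)) ≤ ∑' j, q j := by
      rw [mul_one_div, div_le_iff₀ h0]
      linarith
    nlinarith [Real.add_one_le_exp (-(1 / (B * R)))]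

theorem lintegral_finrank_inf_orthogonal_le {v : ℕ → E} {p : ℕ → ℝ} {B R : ℝ}
    (hB : 0 ≤ B) (hR0 : 0 ≤ R) (hp : ∀ j, 0 ≤ p j) (hps : HasSum p 1)
    (hR : ∀ j, ‖v j‖ ^ 2 ≤ R * p j) {K : Submodule ℂ E}
    (hlow : ∀ x ∈ K, Summable (fun j => ‖inner ℂ (v j) x‖ ^ 2) ∧
      ‖x‖ ^ 2 ≤ B * ∑' j, ‖inner ℂ (v j) x‖ ^ 2)
    {μ : Measure ℕ} (hμ : ∀ j, μ {j} = ENNReal.ofReal (p j)) :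
    ∫⁻ j, (Module.finrank ℂ ↥(K ⊓ (ℂ ∙ v j)ᗮ) : ENNReal) ∂μ ≤
      ENNReal.ofReal (Real.exp (-(1 / (B * R)))) * Module.finrank ℂ K := by
  obtain ⟨h1, h2⟩ := tsum_finrank_inf_orthogonal_le hB hR0 hp hps hR hlow
  have := ENNReal.ofReal_le_ofReal h2
  rw [ENNReal.ofReal_tsum_of_nonneg (fun j => mul_nonneg (hp j) (Nat.cast_nonneg _)) h1,
    ENNReal.ofReal_mul (Real.exp_nonneg _), ENNReal.ofReal_natCast] at this
  rw [lintegral_countable']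
  convert this using 3 with j
  rw [hμ, ENNReal.ofReal_mul (hp j), ENNReal.ofReal_natCast, mul_comm]

omit [FiniteDimensional ℂ E] in
theorem lintegral_finrank_unseenPart_le {v : ℕ → E} {V : Submodule ℂ E} {μ : Measure ℕ}
    [IsProbabilityMeasure μ] {a : ENNReal}
    (hstep : ∀ K ≤ V, ∫⁻ j, (Module.finrank ℂ ↥(K ⊓ (ℂ ∙ v j)ᗮ) : ENNReal) ∂μ ≤
      a * Module.finrank ℂ K) (k : ℕ) :
    ∫⁻ i : Fin k → ℕ, (Module.finrank ℂ (unseenPart V v i) : ENNReal) ∂(Measure.pi fun _ => μ) ≤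
      a ^ k * Module.finrank ℂ V := by
  induction k with
  | zero =>
    have : ∀ i : Fin 0 → ℕ, Module.finrank ℂ (unseenPart V v i) = Module.finrank ℂ V := by
      intro i
      rw [show unseenPart V v i = V by ext x; simp [mem_unseenPart]]
    simp only [this]
    simp
  | succ k ih =>
    have hmp := (measurePreserving_piFinSuccAbove (n := k) (α := fun _ => ℕ) (fun _ => μ) 0).symm
    rw [← hmp.lintegral_comp (measurable_of_countable _), lintegral_prod_symm _
      (measurable_of_countable _).aemeasurable]
    have hcons : ∀ (i : Fin k → ℕ) (j : ℕ), Module.finrank ℂ (unseenPart V v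
        ((MeasurableEquiv.piFinSuccAbove (fun _ : Fin (k + 1) => ℕ) 0).symm (j, i))) =
          Module.finrank ℂ ↥(unseenPart V v i ⊓ (ℂ ∙ v j)ᗮ) := fun i j => by
      rw [MeasurableEquiv.piFinSuccAbove_symm_apply, Fin.insertNthEquiv_zero, ← unseenPart_cons]
      rfl
    simp only [hcons]
    calc _ ≤ ∫⁻ i : Fin k → ℕ, a * Module.finrank ℂ (unseenPart V v i)
              ∂(Measure.pi fun _ => μ) := lintegral_mono fun i => hstep _ inf_le_left
      _ = a * ∫⁻ i : Fin k → ℕ, Module.finrank ℂ (unseenPart V v i)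
              ∂(Measure.pi fun _ => μ) := lintegral_const_mul _ (measurable_of_countable _)
      _ ≤ a * (a ^ k * Module.finrank ℂ V) := by gcongr
      _ = _ := by rw [pow_succ']; ring

/-- With high probability, independent samples leave no unseen direction in `V`: Markov's
inequality for the dimension of the unseen part. -/
theorem measure_unseenPart_eq_bot_ge {v : ℕ → E} {p : ℕ → ℝ} {B R : ℝ}
    (hB : 0 ≤ B) (hR0 : 0 ≤ R) (hp : ∀ j, 0 ≤ p j) (hps : HasSum p 1)
    (hR : ∀ j, ‖v j‖ ^ 2 ≤ R * p j) {V : Submodule ℂ E}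
    (hlow : ∀ x ∈ V, Summable (fun j => ‖inner ℂ (v j) x‖ ^ 2) ∧
      ‖x‖ ^ 2 ≤ B * ∑' j, ‖inner ℂ (v j) x‖ ^ 2)
    {Ω : Type*} [MeasurableSpace Ω] (P : Measure Ω) [IsProbabilityMeasure P] {m : ℕ}
    (i : Fin m → Ω → ℕ) (hi_meas : ∀ t, Measurable (i t)) (hi_indep : iIndepFun i P)
    (hi_law : ∀ t j, P (i t ⁻¹' {j}) = ENNReal.ofReal (p j))
    (hm : 1 ≤ m) {δ : ℝ} (hδ : Real.exp (-(m / (B * R))) * Module.finrank ℂ V ≤ δ) :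
    ENNReal.ofReal (1 - δ) ≤ P {ω | unseenPart V v (fun t => i t ω) = ⊥} := by
  set μ : Measure ℕ := P.map (i ⟨0, hm⟩)
  have hμ : ∀ j, μ {j} = ENNReal.ofReal (p j) := fun j => by
    rw [Measure.map_apply (hi_meas _) (measurableSet_singleton _), hi_law]
  have hμt : ∀ t, P.map (i t) = μ := fun t => Measure.ext_of_singleton fun j => by
    rw [hμ, Measure.map_apply (hi_meas _) (measurableSet_singleton _), hi_law]
  have : IsProbabilityMeasure μ := Measure.isProbabilityMeasure_map (hi_meas _).aemeasurable
  have hmap : P.map (fun ω t => i t ω) = Measure.pi fun _ => μ := by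
    rw [(iIndepFun_iff_map_fun_eq_pi_map fun t => (hi_meas t).aemeasurable).1 hi_indep]
    simp only [hμt]
  have hX : Measurable fun ω t => i t ω := measurable_pi_lambda _ hi_meas
  have hint := lintegral_finrank_unseenPart_le (V := V) (v := v) (μ := μ)
    (fun K hK => lintegral_finrank_inf_orthogonal_le hB hR0 hp hps hR
      (fun x hx => hlow x (hK hx)) hμ) m
  have hbound : ∫⁻ i : Fin m → ℕ, (Module.finrank ℂ (unseenPart V v i) : ENNReal)
      ∂(Measure.pi fun _ => μ) ≤ ENNReal.ofReal δ := by
    refine hint.trans ?_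
    rw [← ENNReal.ofReal_pow (Real.exp_nonneg _), ← Real.exp_nat_mul, ← ENNReal.ofReal_natCast,
      ← ENNReal.ofReal_mul (Real.exp_nonneg _)]
    refine ENNReal.ofReal_le_ofReal (le_trans (le_of_eq ?_) hδ)
    congr 2
    ring
  have hbad : P {ω | unseenPart V v (fun t => i t ω) = ⊥}ᶜ ≤ ENNReal.ofReal δ := by
    have := mul_meas_ge_le_lintegral (μ := Measure.pi fun _ : Fin m => μ)
      (f := fun i => (Module.finrank ℂ (unseenPart V v i) : ENNReal)) (measurable_of_countable _) 1
    rw [one_mul, ← hmap, Measure.map_apply hX (Set.to_countable _).measurableSet, hmap] at this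
    refine le_trans (measure_mono fun ω hω => ?_) (this.trans hbound)
    have : Module.finrank ℂ (unseenPart V v (fun t => i t ω)) ≠ 0 := fun h =>
      hω (Submodule.finrank_eq_zero.1 h)
    simpa [Nat.one_le_iff_ne_zero] using this
  have hmeas : MeasurableSet {ω | unseenPart V v (fun t => i t ω) = ⊥} :=
    hX (Set.to_countable {i : Fin m → ℕ | unseenPart V v i = ⊥}).measurableSet
  have hδ0 : 0 ≤ δ := le_trans (by positivity) hδ
  rw [ENNReal.ofReal_sub _ hδ0, ENNReal.ofReal_one, tsub_le_iff_right]
  calc (1 : ENNReal) = P {ω | unseenPart V v (fun t => i t ω) = ⊥} +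
        P {ω | unseenPart V v (fun t => i t ω) = ⊥}ᶜ := by
        rw [measure_add_measure_compl hmeas, measure_univ]
    _ ≤ _ := by gcongr

end RandomSections

/-! ### Pseudo-inverses and least squares -/

section LeastSquares

variable {E : Type*} [NormedAddCommGroup E] [InnerProductSpace ℂ E] [FiniteDimensional ℂ E]
  {F : Type*} [NormedAddCommGroup F] [InnerProductSpace ℂ F]

theorem map_pinv_map [FiniteDimensional ℂ F] (A : E →L[ℂ] F) (x : E) : A (pinv A (A x)) = A x :=
  congrArg (fun T : E →L[ℂ] F => T x) (pinv_spec A).mul_mul_left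

/-- `A† A` fixes the vectors orthogonal to the kernel of `A`. -/
theorem pinv_map_of_mem_orthogonal [FiniteDimensional ℂ F] (A : E →L[ℂ] F) {x : E}
    (hx : ∀ k, A k = 0 → inner ℂ k x = 0) : pinv A (A x) = x := by
  have hk : A (x - pinv A (A x)) = 0 := by rw [map_sub, map_pinv_map, sub_self]
  have hsa := (pinv_spec A).selfAdjoint_right
  have h2 : inner ℂ (x - pinv A (A x)) (pinv A (A x)) = 0 := by
    have := ContinuousLinearMap.adjoint_inner_left (pinv A ∘L A) x (x - pinv A (A x))
    rw [ContinuousLinearMap.isSelfAdjoint_iff'.1 hsa] at this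
    simp only [ContinuousLinearMap.comp_apply, hk, map_zero, inner_zero_left] at this
    exact this.symm
  have h3 : inner ℂ (x - pinv A (A x)) (x - pinv A (A x)) = 0 := by
    conv_lhs => rw [inner_sub_right]
    rw [hx _ hk, h2, sub_zero]
  exact (sub_eq_zero.1 (inner_self_eq_zero.1 h3)).symm

/-- A least-squares problem in a finite-dimensional space of unknowns has exactly one
minimizer of minimal norm; it solves the normal equations and is orthogonal to the kernel. -/
theorem exists_isMinNormMinimizer_unique (T : E →ₗ[ℂ] F) (b : F) :
    ∃ x₀, (∀ x, IsMinNormMinimizer (fun y => ‖T y - b‖ ^ 2) x ↔ x = x₀) ∧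
      (∀ h, inner ℂ (T h) (b - T x₀) = 0) ∧ ∀ k, T k = 0 → inner ℂ k x₀ = 0 := by
  obtain ⟨z, hz⟩ : (LinearMap.range T).starProjection b ∈ LinearMap.range T :=
    Submodule.starProjection_apply_mem _ _
  set x₀ := (LinearMap.ker T)ᗮ.starProjection z
  have hTx₀ : T x₀ = T z := by
    have h : z - x₀ ∈ (LinearMap.ker T)ᗮᗮ := Submodule.sub_starProjection_mem_orthogonal z
    rw [Submodule.orthogonal_orthogonal, LinearMap.mem_ker, map_sub, sub_eq_zero] at h
    exact h.symm
  have hort : ∀ k, T k = 0 → inner ℂ k x₀ = 0 := fun k hk =>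
    Submodule.starProjection_apply_mem (LinearMap.ker T)ᗮ z k (LinearMap.mem_ker.2 hk)
  have hnormal : ∀ h, inner ℂ (T h) (b - T x₀) = 0 := fun h => by
    rw [hTx₀, hz]
    exact Submodule.sub_starProjection_mem_orthogonal b _ ⟨h, rfl⟩
  have hpyth : ∀ x, ‖T x - b‖ ^ 2 = ‖T x - T x₀‖ ^ 2 + ‖T x₀ - b‖ ^ 2 := fun x => by
    have h0 : inner ℂ (T x - T x₀) (T x₀ - b) = 0 := by
      rw [← map_sub, ← neg_sub b, inner_neg_right, hnormal, neg_zero]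
    have := norm_add_sq_eq_norm_sq_add_norm_sq_of_inner_eq_zero _ _ h0
    rw [sub_add_sub_cancel] at this
    simpa [pow_two] using this
  have harg : ∀ x, x ∈ argmin (fun y => ‖T y - b‖ ^ 2) ↔ T (x - x₀) = 0 := fun x => by
    constructor
    · intro hx
      have h1 := hx x₀
      simp only [hpyth x] at h1
      have h2 : ‖T x - T x₀‖ ^ 2 ≤ 0 := by linarith
      rw [map_sub, ← norm_eq_zero]
      exact pow_eq_zero_iff two_ne_zero |>.1 (le_antisymm h2 (sq_nonneg _))
    · intro hx y
      rw [map_sub, sub_eq_zero] at hx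
      simp only [hpyth y, hx]
      exact le_add_of_nonneg_left (sq_nonneg _)
  have hmin : ∀ x, T (x - x₀) = 0 → ‖x‖ ^ 2 = ‖x - x₀‖ ^ 2 + ‖x₀‖ ^ 2 := fun x hx => by
    have := norm_add_sq_eq_norm_sq_add_norm_sq_of_inner_eq_zero _ _ (hort _ hx)
    rw [sub_add_cancel] at this
    simpa [pow_two] using this
  refine ⟨x₀, fun x => ⟨fun hx => ?_, ?_⟩, hnormal, hort⟩
  · have h1 := hmin x ((harg x).1 hx.1)
    have h2 := hx.2 x₀ ((harg x₀).2 (by simp))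
    have h3 : ‖x - x₀‖ ^ 2 ≤ 0 := by nlinarith [norm_nonneg x]
    exact sub_eq_zero.1 (norm_eq_zero.1
      (pow_eq_zero_iff two_ne_zero |>.1 (le_antisymm h3 (sq_nonneg _))))
  · rintro rfl
    refine ⟨(harg _).2 (by simp), fun y hy => ?_⟩
    have := hmin y ((harg y).1 hy)
    exact le_of_sq_le_sq (by linarith [sq_nonneg ‖y - x₀‖]) (norm_nonneg _)

end LeastSquares

/-! ### Coordinates of the sampling operators -/

section Sampling

variable {H : Type*} [NormedAddCommGroup H] [InnerProductSpace ℂ H] [CompleteSpace H]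

theorem inner_stdBasis_left (j : ℕ) (y : Ell2) : inner ℂ (stdBasis j) y = y j := by
  rw [stdBasis, lp.inner_single_left]
  simp

theorem synthesis_stdBasis (v : ℕ → H) (hv : IsFrameForSpan v) (j : ℕ) :
    synthesis v hv (stdBasis j) = v j := by
  refine (hasSum_synthesis v hv (stdBasis j)).unique ?_
  convert hasSum_single (f := fun k => (stdBasis j : Ell2) k • v k) j ?_ using 1
  · simp [stdBasis]
  · intro k hk
    simp [stdBasis, hk]

theorem adjoint_synthesis_apply (v : ℕ → H) (hv : IsFrameForSpan v) (y : H) (j : ℕ) :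
    ContinuousLinearMap.adjoint (synthesis v hv) y j = inner ℂ (v j) y := by
  rw [← inner_stdBasis_left, ContinuousLinearMap.adjoint_inner_right, synthesis_stdBasis]

theorem embed_apply (n : ℕ) (x : Cn n) : embed n x = ∑ k : Fin n, x k • stdBasis k := rfl

theorem synthesis_embed (w : ℕ → H) (hw : IsFrameForSpan w) (n : ℕ) (x : Cn n) :
    synthesis w hw (embed n x) = ∑ k : Fin n, x k • w k := by
  simp [embed_apply, synthesis_stdBasis]

theorem mem_reconSpace_iff (w : ℕ → H) (hw : IsFrameForSpan w) (n : ℕ) (y : H) :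
    y ∈ reconSpace w n ↔ ∃ x : Cn n, synthesis w hw (embed n x) = y := by
  rw [reconSpace, Submodule.mem_span_range_iff_exists_fun]
  simp only [synthesis_embed]
  constructor
  · rintro ⟨c, hc⟩
    exact ⟨WithLp.toLp 2 c, by simpa using hc⟩
  · rintro ⟨x, hx⟩
    exact ⟨fun k => x k, hx⟩

theorem crossAdj_eq_adjoint (S W : Ell2 →L[ℂ] H) (n : ℕ) :
    crossAdj S W n = ContinuousLinearMap.adjoint (crossOp S W ∘L embed n) := by
  rw [crossAdj, ContinuousLinearMap.adjoint_comp]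

theorem inner_interVec_left (S W : Ell2 →L[ℂ] H) (n j : ℕ) (x : Cn n) :
    inner ℂ (interVec S W n j) x = crossOp S W (embed n x) j := by
  rw [interVec, crossAdj_eq_adjoint, ContinuousLinearMap.adjoint_inner_left, inner_stdBasis_left]
  rfl

theorem inner_interVec_synthesis (s w : ℕ → H) (hs : IsFrameForSpan s) (hw : IsFrameForSpan w)
    (n j : ℕ) (x : Cn n) :
    inner ℂ (interVec (synthesis s hs) (synthesis w hw) n j) x =
      inner ℂ (s j) (synthesis w hw (embed n x)) := by
  rw [inner_interVec_left]
  exact adjoint_synthesis_apply s hs _ j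

theorem hasSum_sq_inner_interVec (S W : Ell2 →L[ℂ] H) (n : ℕ) (x : Cn n) :
    HasSum (fun j => ‖inner ℂ (interVec S W n j) x‖ ^ 2) (‖crossOp S W (embed n x)‖ ^ 2) := by
  have h := lp.hasSum_norm (p := 2) (by norm_num) (crossOp S W (embed n x))
  simp only [ENNReal.toReal_ofNat, Real.rpow_ofNat] at h
  simpa only [inner_interVec_left] using h

theorem crossAdj_weightedProj (S W : Ell2 →L[ℂ] H) (n : ℕ) (p : ℕ → ℝ) {m : ℕ} (i : Fin m → ℕ)
    (y : Ell2) :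
    crossAdj S W n (weightedProj p i y) = ((1 / m : ℝ) : ℂ) •
      ∑ t, (((1 / p (i t) : ℝ) : ℂ) * y (i t)) • interVec S W n (i t) := by
  simp [weightedProj, interVec, inner_stdBasis_left, mul_smul]

/-- If `W ∩ S^⊥ = 0`, then `S* W ι_n` and `W ι_n` have the same kernel. -/
theorem synthesis_embed_eq_zero_of_crossOp {s w : ℕ → H} {hs : IsFrameForSpan s}
    {hw : IsFrameForSpan w} (hWS : closedSpan w ⊓ (closedSpan s)ᗮ = ⊥) {n : ℕ} {x : Cn n}
    (hx : crossOp (synthesis s hs) (synthesis w hw) (embed n x) = 0) :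
    synthesis w hw (embed n x) = 0 := by
  rw [← Submodule.mem_bot ℂ, ← hWS]
  refine ⟨?_, ?_⟩
  · rw [synthesis_embed]
    exact Submodule.sum_mem _ fun k _ => Submodule.smul_mem _ _
      (Submodule.le_topologicalClosure _ (Submodule.subset_span ⟨k, rfl⟩))
  · rw [SetLike.mem_coe, closedSpan, Submodule.orthogonal_closure, Submodule.mem_orthogonal]
    intro u hu
    induction hu using Submodule.span_induction with
    | mem u hu =>
      obtain ⟨j, rfl⟩ := hu
      rw [← inner_interVec_synthesis s w hs hw, inner_interVec_left, hx]
      rfl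
    | zero => simp
    | add a b _ _ ha hb => simp [inner_add_left, ha, hb]
    | smul c a _ ha => simp [inner_smul_left, ha]

/-- On the orthogonal complement of its kernel, `S* W ι_n` is bounded below, with a constant in
terms of `Σ = (S* W ι_n)* (S* W ι_n)` and its pseudo-inverse. -/
theorem norm_sq_le_of_mem_orthogonal_ker (S W : Ell2 →L[ℂ] H) (n : ℕ) {x : Cn n}
    (hx : ∀ k, crossOp S W (embed n k) = 0 → inner ℂ k x = 0) :
    ‖x‖ ^ 2 ≤ ‖gram S W n‖ * ‖pinv (gram S W n)‖ ^ 2 * ‖crossOp S W (embed n x)‖ ^ 2 := by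
  set A : Cn n →L[ℂ] Ell2 := crossOp S W ∘L embed n with hA
  have hG : gram S W n = ContinuousLinearMap.adjoint A ∘L A := by
    rw [gram, crossAdj_eq_adjoint]
  have hker : ∀ k, gram S W n k = 0 → inner ℂ k x = 0 := fun k hk => by
    refine hx k ?_
    have h1 : inner ℂ (A k) (A k) = 0 := by
      rw [← ContinuousLinearMap.adjoint_inner_left]
      rw [hG, ContinuousLinearMap.comp_apply] at hk
      rw [hk, inner_zero_left]
    exact inner_self_eq_zero.1 h1
  have h2 : ‖x‖ ≤ ‖pinv (gram S W n)‖ * (‖A‖ * ‖A x‖) := by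
    calc ‖x‖ = ‖pinv (gram S W n) (ContinuousLinearMap.adjoint A (A x))‖ := by
          conv_lhs => rw [← pinv_map_of_mem_orthogonal (gram S W n) hker]
          rw [hG]
          rfl
      _ ≤ ‖pinv (gram S W n)‖ * (‖ContinuousLinearMap.adjoint A‖ * ‖A x‖) :=
        (ContinuousLinearMap.le_opNorm _ _).trans
          (by gcongr; exact ContinuousLinearMap.le_opNorm _ _)
      _ = _ := by rw [LinearIsometryEquiv.norm_map]
  have h3 : ‖gram S W n‖ = ‖A‖ * ‖A‖ := by
    rw [hG]
    exact ContinuousLinearMap.norm_adjoint_comp_self A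
  rw [h3]
  calc ‖x‖ ^ 2 ≤ (‖pinv (gram S W n)‖ * (‖A‖ * ‖A x‖)) ^ 2 := by gcongr
    _ = ‖A‖ * ‖A‖ * ‖pinv (gram S W n)‖ ^ 2 * ‖A x‖ ^ 2 := by ring

/-- The empirical Gram matrix only annihilates vectors orthogonal to all sampled `v_j`. -/
theorem inner_interVec_eq_zero_of_empGram {S W : Ell2 →L[ℂ] H} {n : ℕ} {p : ℕ → ℝ}
    (hp : ∀ j, 0 ≤ p j) (hsupp : ∀ j, interVec S W n j ≠ 0 → 0 < p j) {m : ℕ} (hm : 1 ≤ m)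
    {i : Fin m → ℕ} {x : Cn n} (hx : empGram S W n p i x = 0) (t : Fin m) :
    inner ℂ (interVec S W n (i t)) x = 0 := by
  have h0 : (((1 / m : ℝ) : ℂ)) ≠ 0 := by
    norm_cast
    positivity
  have h1 : ∑ t, (((1 / p (i t) : ℝ) : ℂ) * inner ℂ (interVec S W n (i t)) x) •
      interVec S W n (i t) = 0 := by
    have h := hx
    simp only [empGram, ContinuousLinearMap.comp_apply] at h
    rw [crossAdj_weightedProj, smul_eq_zero_iff_right h0] at h
    simpa only [inner_interVec_left] using h
  have h2 : ∑ t, 1 / p (i t) * ‖inner ℂ (interVec S W n (i t)) x‖ ^ 2 = 0 := by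
    have h := congrArg (fun y => inner ℂ x y) h1
    simp only [inner_sum, inner_smul_right, inner_zero_right, mul_assoc] at h
    rw [← Complex.ofReal_inj, Complex.ofReal_sum, Complex.ofReal_zero, ← h]
    refine Finset.sum_congr rfl fun t _ => ?_
    rw [← inner_conj_symm x, Complex.mul_conj, Complex.normSq_eq_norm_sq, Complex.ofReal_mul]
  have h3 := (Finset.sum_eq_zero_iff_of_nonneg fun t _ =>
    mul_nonneg (one_div_nonneg.2 (hp _)) (sq_nonneg _)).1 h2 t (Finset.mem_univ t)
  by_cases hv : interVec S W n (i t) = 0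
  · rw [hv, inner_zero_left]
  · have := hsupp _ hv
    simpa [this.ne'] using h3

/-- The minimal-norm solution of the weighted least-squares problem exists, is unique, and equals
`Σ̂_Ω† ι_n* U* Q_Ω S* f`. -/
theorem isMinNormMinimizer_lsObjective_iff (s w : ℕ → H) (hs : IsFrameForSpan s)
    (hw : IsFrameForSpan w) (f : H) (n : ℕ) {p : ℕ → ℝ} (hp : ∀ j, 0 ≤ p j)
    (hsupp : ∀ j, interVec (synthesis s hs) (synthesis w hw) n j ≠ 0 → 0 < p j) {m : ℕ}
    (hm : 1 ≤ m) (i : Fin m → ℕ) (x : Cn n) :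
    IsMinNormMinimizer (lsObjective (synthesis w hw) s f n p i) x ↔
      x = pinv (empGram (synthesis s hs) (synthesis w hw) n p i)
        (crossAdj (synthesis s hs) (synthesis w hw) n (weightedProj p i
          (ContinuousLinearMap.adjoint (synthesis s hs) f))) := by
  set S := synthesis s hs
  set W := synthesis w hw
  -- the objective is `‖T y - b‖²`; a sample with `p (i t) = 0` has weight `1 / 0 = 0` here as in
  -- `weightedProj`
  let T : Cn n →ₗ[ℂ] Cn m := (WithLp.linearEquiv 2 ℂ (Fin m → ℂ)).symm.toLinearMap ∘ₗ
    LinearMap.pi fun t => ((√(1 / p (i t)) : ℝ) : ℂ) •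
      (innerSL ℂ (interVec S W n (i t))).toLinearMap
  have hT : ∀ x t, T x t = ((√(1 / p (i t)) : ℝ) : ℂ) * inner ℂ (interVec S W n (i t)) x :=
    fun x t => rfl
  let b : Cn m := WithLp.toLp 2 fun t => ((√(1 / p (i t)) : ℝ) : ℂ) * inner ℂ (s (i t)) f
  have hw0 : ∀ t, 0 ≤ 1 / p (i t) := fun t => one_div_nonneg.2 (hp _)
  have hobj : lsObjective W s f n p i = fun y => ‖T y - b‖ ^ 2 := by
    funext y
    rw [EuclideanSpace.norm_sq_eq, lsObjective]
    refine Finset.sum_congr rfl fun t _ => ?_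
    rw [PiLp.sub_apply, hT, inner_interVec_synthesis]
    simp only [b]
    rw [← mul_sub, norm_mul, mul_pow, Complex.norm_real, Real.norm_of_nonneg (Real.sqrt_nonneg _),
      Real.sq_sqrt (hw0 t)]
  obtain ⟨x₀, hx₀, hnormal, hort⟩ := exists_isMinNormMinimizer_unique T b
  rw [hobj, hx₀]
  suffices h : pinv (empGram S W n p i) (crossAdj S W n (weightedProj p i
      (ContinuousLinearMap.adjoint S f))) = x₀ by rw [h]
  have hsolve : empGram S W n p i x₀ =
      crossAdj S W n (weightedProj p i (ContinuousLinearMap.adjoint S f)) := by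
    simp only [empGram, ContinuousLinearMap.comp_apply]
    rw [crossAdj_weightedProj, crossAdj_weightedProj]
    congr 1
    rw [eq_comm, ← sub_eq_zero, ← Finset.sum_sub_distrib]
    refine ext_inner_left ℂ fun h => ?_
    rw [inner_zero_right, ← hnormal h, PiLp.inner_apply (T h), inner_sum]
    refine Finset.sum_congr rfl fun t _ => ?_
    have hsq : ((√(1 / p (i t)) : ℝ) : ℂ) * ((√(1 / p (i t)) : ℝ) : ℂ) =
        ((1 / p (i t) : ℝ) : ℂ) := by
      rw [← Complex.ofReal_mul, Real.mul_self_sqrt (hw0 t)]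
    rw [PiLp.sub_apply, hT, hT, ← sub_smul, inner_smul_right, adjoint_synthesis_apply,
      ← inner_interVec_left, ← hsq, RCLike.inner_apply, map_mul, Complex.conj_ofReal,
      inner_conj_symm]
    simp only [b]
    ring
  rw [← hsolve]
  refine pinv_map_of_mem_orthogonal _ fun k hk => hort k ?_
  ext t
  rw [hT, inner_interVec_eq_zero_of_empGram hp hsupp hm hk t, mul_zero]
  rfl

/-- Once `Σ̂_Ω` annihilates only the kernel of `W ι_n`, the reconstruction reproduces the component
of `f` in `W_n` exactly, so the error splits orthogonally into `P_{W_n^⊥} f` and its alias. -/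
theorem norm_sub_reconstruction_le (s w : ℕ → H) (hs : IsFrameForSpan s)
    (hw : IsFrameForSpan w) (f : H) (n : ℕ) {p : ℕ → ℝ} {m : ℕ} (i : Fin m → ℕ)
    (hker : ∀ k, empGram (synthesis s hs) (synthesis w hw) n p i k = 0 →
      synthesis w hw (embed n k) = 0) :
    ‖f - synthesis w hw (embed n (pinv (empGram (synthesis s hs) (synthesis w hw) n p i)
        (crossAdj (synthesis s hs) (synthesis w hw) n (weightedProj p i
          (ContinuousLinearMap.adjoint (synthesis s hs) f)))))‖ ≤
      ‖tailProj w n f‖ * √(1 + aliasConst (synthesis s hs) (synthesis w hw) w n p i ^ 2) := by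
  set S := synthesis s hs
  set W := synthesis w hw
  set G := empGram S W n p i with hG
  have hfin : FiniteDimensional ℂ (reconSpace w n) :=
    FiniteDimensional.span_of_finite ℂ (Set.finite_range _)
  obtain ⟨z, hz⟩ := (mem_reconSpace_iff w hw n _).1
    (Submodule.starProjection_apply_mem (reconSpace w n) f)
  have hsplit : f = W (embed n z) + tailProj w n f := by
    rw [hz, tailProj, Submodule.starProjection_add_starProjection_orthogonal]
  have hidem : tailProj w n (tailProj w n f) = tailProj w n f :=
    Submodule.starProjection_eq_self_iff.2 (Submodule.starProjection_apply_mem _ _)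
  have hd : crossAdj S W n (weightedProj p i (ContinuousLinearMap.adjoint S f)) =
      G z + empCross S W w n p i (tailProj w n f) := by
    conv_lhs => rw [hsplit]
    simp only [map_add, hG, empGram, empCross, crossOp, ContinuousLinearMap.comp_apply, hidem]
  set r := W (embed n (pinv G (empCross S W w n p i (tailProj w n f))))
  have hrec : W (embed n (pinv G (G z))) = W (embed n z) := by
    have := hker (pinv G (G z) - z) (by rw [map_sub, map_pinv_map, sub_self])
    rwa [map_sub, map_sub, sub_eq_zero] at this
  have herr : f - W (embed n (pinv G (crossAdj S W n (weightedProj p i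
      (ContinuousLinearMap.adjoint S f))))) = tailProj w n f - r := by
    rw [hd, map_add, map_add, map_add, hrec]
    nth_rewrite 1 [hsplit]
    abel
  have horth : inner ℂ (tailProj w n f) r = 0 :=
    Submodule.inner_left_of_mem_orthogonal ((mem_reconSpace_iff w hw n r).2 ⟨_, rfl⟩)
      (Submodule.starProjection_apply_mem _ _)
  have hrle : ‖r‖ ≤ aliasConst S W w n p i * ‖tailProj w n f‖ :=
    ContinuousLinearMap.le_opNorm (W ∘L embed n ∘L pinv G ∘L empCross S W w n p i) _
  rw [herr]
  refine le_of_sq_le_sq ?_ (by positivity)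
  rw [mul_pow, Real.sq_sqrt (by positivity), norm_sub_sq (𝕜 := ℂ), horth]
  have : ‖r‖ ^ 2 ≤ (aliasConst S W w n p i * ‖tailProj w n f‖) ^ 2 := by gcongr
  simp only [map_zero, mul_zero, sub_zero]
  linarith [mul_pow (aliasConst S W w n p i) ‖tailProj w n f‖ 2]

end Sampling

/-! ### The reconstruction guarantee -/

theorem sq_norm_le_coherence_mul {E : Type*} [NormedAddCommGroup E] {p : ℕ → ℝ} {v : ℕ → E}
    (hp : ∀ j, 0 ≤ p j) (hR : BddAbove (coherenceSet p v)) (hsupp : ∀ j, v j ≠ 0 → 0 < p j)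
    (j : ℕ) : ‖v j‖ ^ 2 ≤ coherence p v * p j := by
  rcases (hp j).eq_or_lt with h | h
  · have : v j = 0 := by_contra fun hv => h.not_lt (hsupp j hv)
    simp [this, ← h]
  · rw [← div_le_iff₀ h]
    exact le_csSup hR ⟨j, h, rfl⟩

theorem coherence_nonneg {E : Type*} [NormedAddCommGroup E] {p : ℕ → ℝ} {v : ℕ → E} :
    0 ≤ coherence p v := by
  refine Real.sSup_nonneg ?_
  rintro _ ⟨j, hj, rfl⟩
  positivity

/-- The constant `8 / 3` and the factor `2` in the logarithm are more than is needed here: `1` would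
do for both. -/
theorem exp_neg_div_mul_le_of_log_le {m c δ : ℝ} {n : ℕ} (hn : 1 ≤ n) (hδ_pos : 0 < δ)
    (hδ_lt : δ < 1) (hc : 0 < c) (hsample : 8 / 3 * c * Real.log (2 * n / δ) ≤ m) :
    Real.exp (-(m / c)) * n ≤ δ := by
  have hn' : (1 : ℝ) ≤ n := by exact_mod_cast hn
  have hlog : 0 ≤ Real.log (2 * n / δ) := Real.log_nonneg (by rw [le_div_iff₀ hδ_pos]; linarith)
  have h1 : Real.log (2 * n / δ) ≤ m / c := by
    rw [le_div_iff₀ hc]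
    nlinarith [mul_nonneg hlog hc.le]
  have h2 : Real.exp (-(m / c)) ≤ δ / (2 * n) := by
    calc _ ≤ Real.exp (-Real.log (2 * n / δ)) := by gcongr
      _ = δ / (2 * n) := by rw [Real.exp_neg, Real.exp_log (by positivity), inv_div]
  calc _ ≤ δ / (2 * n) * n := by gcongr
    _ = δ / 2 := by field_simp
    _ ≤ δ := by linarith

theorem theorem3p9
    {H : Type*} [NormedAddCommGroup H] [InnerProductSpace ℂ H] [CompleteSpace H]
    [TopologicalSpace.SeparableSpace H]
    (s w : ℕ → H) (hs : IsFrameForSpan s) (hw : IsFrameForSpan w)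
    (f : H) (n m : ℕ) (hn : 1 ≤ n) (hm : 1 ≤ m)
    -- the probability distribution `p` on the indices
    (p : ℕ → ℝ) (hp_nonneg : ∀ j, 0 ≤ p j) (hp_sum : HasSum p 1)
    -- the standing assumptions
    (hWS : closedSpan w ⊓ (closedSpan s)ᗮ = ⊥)
    (hR : BddAbove (coherenceSet p (interVec (synthesis s hs) (synthesis w hw) n)))
    (hR' : BddAbove (coherenceSet p (fun j => tailProj w n (s j))))
    (hsupp : ∀ j, interVec (synthesis s hs) (synthesis w hw) n j ≠ 0 → 0 < p j)
    -- the i.i.d. sample indices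
    {Ω : Type*} [MeasurableSpace Ω] (P : Measure Ω) [IsProbabilityMeasure P]
    (i : Fin m → Ω → ℕ) (hi_meas : ∀ t, Measurable (i t)) (hi_indep : iIndepFun i P)
    (hi_law : ∀ t j, P (i t ⁻¹' {j}) = ENNReal.ofReal (p j))
    (δ : ℝ) (hδ_pos : 0 < δ) (hδ_lt : δ < 1)
    (hsample : 8 / 3 * coherence p (interVec (synthesis s hs) (synthesis w hw) n)
        * ‖gram (synthesis s hs) (synthesis w hw) n‖
        * ‖pinv (gram (synthesis s hs) (synthesis w hw) n)‖ ^ 2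
        * Real.log (2 * n / δ) ≤ m) :
    ENNReal.ofReal (1 - δ) ≤ P {ω |
      (∃! x : Cn n, IsMinNormMinimizer
        (lsObjective (synthesis w hw) s f n p (fun t => i t ω)) x) ∧
      ∀ x : Cn n, IsMinNormMinimizer
        (lsObjective (synthesis w hw) s f n p (fun t => i t ω)) x →
        ‖f - synthesis w hw (embed n x)‖ ≤ ‖tailProj w n f‖ *
          Real.sqrt (1 + aliasConst (synthesis s hs) (synthesis w hw) w n p
            (fun t => i t ω) ^ 2)} := by
  set S := synthesis s hs
  set W := synthesis w hw
  set v := interVec S W n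
  set R := coherence p v
  set B := ‖gram S W n‖ * ‖pinv (gram S W n)‖ ^ 2 with hB
  set N : Submodule ℂ (Cn n) := LinearMap.ker (crossOp S W ∘L embed n).toLinearMap
  have hB0 : 0 ≤ B := by positivity
  have hRp := sq_norm_le_coherence_mul hp_nonneg hR hsupp
  have hlow : ∀ x ∈ Nᗮ, Summable (fun j => ‖inner ℂ (v j) x‖ ^ 2) ∧
      ‖x‖ ^ 2 ≤ B * ∑' j, ‖inner ℂ (v j) x‖ ^ 2 := fun x hx => by
    have h := hasSum_sq_inner_interVec S W n x
    refine ⟨h.summable, ?_⟩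
    rw [h.tsum_eq]
    exact norm_sq_le_of_mem_orthogonal_ker S W n fun k hk => hx k hk
  have hfail : Real.exp (-(m / (B * R))) * Module.finrank ℂ ↥Nᗮ ≤ δ := by
    rcases (mul_nonneg hB0 (coherence_nonneg (p := p) (v := v))).eq_or_lt with h0 | h0
    · -- if `B * R = 0` then `U ι_n = 0`, and there is nothing to sample
      have := finrank_le_tsum_not_orthogonal hB0 hp_nonneg hp_sum.summable hRp hlow
      rw [← h0, zero_mul] at this
      exact (mul_nonpos_of_nonneg_of_nonpos (Real.exp_nonneg _) this).trans hδ_pos.le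
    · have hrank : (Module.finrank ℂ ↥Nᗮ : ℝ) ≤ n := by
        have := Submodule.finrank_le Nᗮ
        rw [finrank_euclideanSpace_fin] at this
        exact_mod_cast this
      refine le_trans (by gcongr) (exp_neg_div_mul_le_of_log_le hn hδ_pos hδ_lt h0 ?_)
      refine le_trans (le_of_eq ?_) hsample
      rw [hB]
      ring
  refine (measure_unseenPart_eq_bot_ge hB0 coherence_nonneg hp_nonneg hp_sum hRp hlow P i hi_meas
    hi_indep hi_law hm hfail).trans (measure_mono fun ω hω => ?_)
  have hω : unseenPart Nᗮ v (fun t => i t ω) = ⊥ := hω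
  have hker : ∀ k, empGram S W n p (fun t => i t ω) k = 0 → W (embed n k) = 0 := fun k hk => by
    refine synthesis_embed_eq_zero_of_crossOp (hs := hs) hWS ?_
    have hkN : crossOp S W (embed n (k - N.starProjection k)) = crossOp S W (embed n k) := by
      have : crossOp S W (embed n (N.starProjection k)) = 0 :=
        Submodule.starProjection_apply_mem N k
      rw [map_sub, map_sub, this, sub_zero]
    have hmem : k - N.starProjection k ∈ unseenPart Nᗮ v (fun t => i t ω) := by
      refine mem_unseenPart.2 ⟨Submodule.sub_starProjection_mem_orthogonal k, fun t => ?_⟩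
      have := inner_interVec_eq_zero_of_empGram hp_nonneg hsupp hm hk t
      rw [inner_interVec_left] at this ⊢
      rwa [hkN]
    rw [hω, Submodule.mem_bot] at hmem
    rw [← hkN, hmem, map_zero, map_zero]
  have hiff := isMinNormMinimizer_lsObjective_iff s w hs hw f n hp_nonneg hsupp hm
    (fun t => i t ω)
  refine ⟨⟨_, (hiff _).2 rfl, fun y hy => (hiff y).1 hy⟩, fun x hx => ?_⟩
  rw [(hiff x).1 hx]
  exact norm_sub_reconstruction_le s w hs hw f n (fun t => i t ω) hker
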